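/- Let a clique-decomposition of the complete graph $K_n$ on $n$ labelled vertices be a set of cliques of $K_n$, each with at least two vertices, such that every edge of $K_n$ lies in exactly one of them. For every $L\in\mathbb N$ there are a constant $c>0$ and an integer $n_0$, both depending only on $L$, such that the following holds for all $n\ge n_0$ and all non-negative integers $s_2,\dots,s_L$ with $$\sum_{k=2}^L\binom k2 s_k=\binom n2 .$$ Let $\Gamma_{s_2,\dots,s_L}$ be the set of all clique-decompositions of $K_n$ in which, for each $2\le k\le L$, the number of cliques with exactly $k$ vertices is $s_k$. Then $$|\Gamma_{s_2,\dots,s_L}|\le \exp\left(\sum_{k=2}^L s_k\left(\log\binom nk-\log s_k+1\right)-\binom n2+n^{2-c}\right),$$ where $\log$ is the natural logarithm and a summand with $s_k=0$ is read as $0$. -/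

import Mathlib

/-- `P` is a clique-decomposition of the graph `G`: a set of cliques of `G` (given by their vertex
sets), each containing at least one edge, i.e. having at least two vertices, such that every edge
of `G` lies in exactly one of them. -/
def IsCliqueDecomposition {V : Type*} (G : SimpleGraph V) (P : Finset (Finset V)) : Prop :=
  (∀ C ∈ P, 2 ≤ C.card ∧ G.IsClique (C : Set V)) ∧
    ∀ u v : V, G.Adj u v → ∃! C : Finset V, C ∈ P ∧ u ∈ C ∧ v ∈ C

/-- The set of all clique-decompositions of the complete graph `K_n` on `n` labelled vertices in
which, for each `2 ≤ k ≤ L`, the number of cliques with exactly `k` vertices is `s k`.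
(Only the values `s 2, …, s L` matter. If `∑ k ∈ [2, L], (k choose 2) * s k = n choose 2`, these
cliques already cover every edge, so there are no cliques with more than `L` vertices.) -/
def prescribedCliqueDecompositions (n L : ℕ) (s : ℕ → ℕ) : Set (Finset (Finset (Fin n))) :=
  {P | IsCliqueDecomposition (⊤ : SimpleGraph (Fin n)) P ∧
    ∀ k ∈ Finset.Icc 2 L, (P.filter (fun C => C.card = k)).card = s k}

/-!
The bound comes from a random process which builds a decomposition one clique at a time. Let
`m = ∑ s k`. When the set `Q` of cliques has been chosen, the process picks a size `k` with
probability `s k / m` and then a uniform `k`-set among the `A_k(Q)` many that share no edge with a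
member of `Q`. The probabilities `F(P)` that the set of the first `m` choices is `P` add up to at
most one over all `P` (`sum_processWeight_le_one`), so it suffices to bound `F(P)` from below for
every decomposition `P` with the prescribed clique numbers.

Up to the factor `m!`, `F(P)` is the average over all orderings of `P` of a product of step
probabilities. By the inequality of arithmetic and geometric means, `log F(P)` is at least `log m!`
plus the average of the sum of the logarithms of the step probabilities (`le_log_processWeight`);
this average only involves, for each `x ∈ P` and `j < m`, a uniform `j`-subset `Q` of `P \ {x}`.
By Jensen's inequality, the average of `log A_k(Q)` is at most the logarithm of the average of
`A_k(Q)`. All but a fraction `O(1 / n)` of the `k`-sets have their `k choose 2` edges in distinct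
cliques of `P`, all different from `x`, and such a set is still available with probability at most
`q ^ (k choose 2)`, where `q = 1 - j / (m - 1)` (`sum_card_availableCliques_le`). So the average of
`A_k(Q)` is at most `(n choose k) * (q ^ (k choose 2) + O(1 / n))`, hence at most
`(n choose k) * (q + η) ^ (k choose 2)` with `η` a small negative power of `n`. As the average of
`log (q + η)` over `j` is `-1` up to a small error (`sum_log_div_add_le`), the factors
`(q + η) ^ (k choose 2)` contribute `∑ (k choose 2) * s k = n choose 2` times `-1` to the sum of
the `log A_k`, which is the term `-(n choose 2)` of the bound. The term `∑ s k = m` comes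
from `m! ≥ (m / e) ^ m`.
-/

open Finset

/-! ### A sequential random process and the AM-GM inequality -/

/-- The probability that a process which selects elements one at a time, and selects `x` after the
set `Q` with probability `p Q x`, has selected exactly the set `P` after `m` steps. The recursion is
on the last element selected. Only sets `P` with `m` elements are meaningful: at `m = 0` the value
is `1` for every `P`. -/
noncomputable def processWeight {α : Type*} [DecidableEq α] (p : Finset α → α → ℝ) :
    ℕ → Finset α → ℝ
  | 0, _ => 1
  | m + 1, P => ∑ x ∈ P, processWeight p m (P.erase x) * p (P.erase x) x

theorem sum_powersetCard_succ_sum_erase {α : Type*} [Fintype α] [DecidableEq α]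
    (f : Finset α → α → ℝ) (m : ℕ) :
    ∑ P ∈ powersetCard (m + 1) (univ : Finset α), ∑ x ∈ P, f (P.erase x) x =
      ∑ Q ∈ powersetCard m (univ : Finset α), ∑ x ∈ Qᶜ, f Q x := by
  rw [Finset.sum_sigma', Finset.sum_sigma']
  refine Finset.sum_nbij' (fun a => ⟨a.1.erase a.2, a.2⟩) (fun a => ⟨insert a.2 a.1, a.2⟩)
    ?_ ?_ ?_ ?_ ?_
  · rintro ⟨P, x⟩ h
    simp only [mem_sigma, mem_powersetCard_univ, mem_compl] at h ⊢
    exact ⟨by rw [card_erase_of_mem h.2, h.1]; rfl, notMem_erase _ _⟩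
  · rintro ⟨P, x⟩ h
    simp only [mem_sigma, mem_powersetCard_univ, mem_compl] at h ⊢
    exact ⟨by rw [card_insert_of_notMem h.2, h.1], mem_insert_self _ _⟩
  · rintro ⟨P, x⟩ h
    simp only [mem_sigma, mem_powersetCard_univ] at h ⊢
    rw [insert_erase h.2]
  · rintro ⟨P, x⟩ h
    simp only [mem_sigma, mem_powersetCard_univ, mem_compl] at h ⊢
    rw [erase_insert h.2]
  · rintro ⟨P, x⟩ h
    rfl

theorem processWeight_nonneg {α : Type*} [DecidableEq α] {p : Finset α → α → ℝ}
    (hp : ∀ Q x, 0 ≤ p Q x) (m : ℕ) (P : Finset α) : 0 ≤ processWeight p m P := by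
  induction m generalizing P with
  | zero => simp [processWeight]
  | succ m ih => exact Finset.sum_nonneg fun x _ => mul_nonneg (ih _) (hp _ _)

/-- The events that the set of the first `m` selected elements is `P` are disjoint. -/
theorem sum_processWeight_le_one {α : Type*} [Fintype α] [DecidableEq α]
    {p : Finset α → α → ℝ} (hp : ∀ Q x, 0 ≤ p Q x) (hsum : ∀ Q, ∑ x, p Q x ≤ 1) (m : ℕ) :
    ∑ P ∈ powersetCard m (univ : Finset α), processWeight p m P ≤ 1 := by
  induction m with
  | zero => simp [processWeight]
  | succ m ih =>
    simp only [processWeight]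
    rw [sum_powersetCard_succ_sum_erase (fun Q x => processWeight p m Q * p Q x) m]
    refine (Finset.sum_le_sum fun Q _ => ?_).trans ih
    · rw [← Finset.mul_sum]
      refine mul_le_of_le_one_right (processWeight_nonneg hp _ _) (le_trans ?_ (hsum Q))
      exact Finset.sum_le_sum_of_subset_of_nonneg (subset_univ _) fun x _ _ => hp _ _

/-- Jensen's inequality for the logarithm of a uniform average. -/
theorem sum_log_div_card_le_log {ι : Type*} (S : Finset ι) (hS : S.Nonempty) (f : ι → ℝ)
    (hf : ∀ i ∈ S, 0 < f i) :
    (∑ i ∈ S, Real.log (f i)) / S.card ≤ Real.log ((∑ i ∈ S, f i) / S.card) := by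
  have h0 : (0 : ℝ) < S.card := by exact_mod_cast hS.card_pos
  have := strictConcaveOn_log_Ioi.concaveOn.le_map_sum (t := S) (w := fun _ => (1 : ℝ) / S.card)
    (p := f) (fun _ _ => by positivity) (by simp [h0.ne']) (fun i hi => hf i hi)
  simp only [smul_eq_mul, ← Finset.mul_sum] at this
  rwa [one_div, inv_mul_eq_div, inv_mul_eq_div] at this

theorem processWeight_pos {α : Type*} [DecidableEq α] {p : Finset α → α → ℝ} (m : ℕ) (P : Finset α)
    (hm : P.card = m) (hp : ∀ Q ⊆ P, ∀ x ∈ P, x ∉ Q → 0 < p Q x) : 0 < processWeight p m P := by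
  induction m generalizing P with
  | zero => simp [processWeight]
  | succ m ih =>
    refine Finset.sum_pos (fun x hx => mul_pos (ih _ ?_ ?_) (hp _ (erase_subset _ _) x hx
      (notMem_erase _ _))) (card_pos.1 (by omega))
    · rw [card_erase_of_mem hx, hm]; rfl
    · exact fun Q hQ y hy => hp Q (hQ.trans (erase_subset _ _)) y (mem_of_mem_erase hy)

/-- A pair `(y, Q)` with `y ∈ P` and `Q ⊆ P \ {y}` of size `j` survives the deletion of `x` from `P`
for exactly `|P| - 1 - j` elements `x`. -/
theorem sum_sum_erase_sum_powersetCard {α : Type*} [DecidableEq α] (P : Finset α) (j : ℕ)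
    (g : Finset α → α → ℝ) :
    ∑ x ∈ P, ∑ y ∈ P.erase x, ∑ Q ∈ powersetCard j ((P.erase x).erase y), g Q y =
      ((P.card : ℝ) - 1 - j) * ∑ y ∈ P, ∑ Q ∈ powersetCard j (P.erase y), g Q y := by
  have h1 : ∑ x ∈ P, ∑ y ∈ P.erase x, ∑ Q ∈ powersetCard j ((P.erase x).erase y), g Q y =
      ∑ y ∈ P, ∑ x ∈ P.erase y, ∑ Q ∈ powersetCard j ((P.erase x).erase y), g Q y :=
    Finset.sum_comm' fun x y => by simp only [mem_erase]; tauto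
  rw [h1, Finset.mul_sum]
  refine Finset.sum_congr rfl fun y hy => ?_
  have h2 : ∑ x ∈ P.erase y, ∑ Q ∈ powersetCard j ((P.erase x).erase y), g Q y =
      ∑ Q ∈ powersetCard j (P.erase y), ∑ x ∈ P.erase y \ Q, g Q y :=
    Finset.sum_comm' fun x Q => by
      simp only [mem_powersetCard, mem_sdiff, subset_iff, mem_erase]
      constructor
      · rintro ⟨hx, hQ, hc⟩
        exact ⟨⟨hx, fun h => (hQ h).2.1 rfl⟩, fun z hz => ⟨(hQ hz).1, (hQ hz).2.2⟩, hc⟩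
      · rintro ⟨⟨hx, hxQ⟩, hQ, hc⟩
        exact ⟨hx, fun z hz => ⟨(hQ hz).1, fun h => hxQ (h ▸ hz), (hQ hz).2⟩, hc⟩
  rw [h2, Finset.mul_sum]
  refine Finset.sum_congr rfl fun Q hQ => ?_
  rw [mem_powersetCard] at hQ
  have h3 := card_sdiff_add_card_eq_card hQ.1
  rw [card_erase_of_mem hy, hQ.2] at h3
  have h4 := card_pos.2 ⟨y, hy⟩
  have h5 : ((P.erase y \ Q).card : ℝ) = (P.card : ℝ) - 1 - j := by
    have : (P.erase y \ Q).card + j + 1 = P.card := by omega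
    rw [← this]; push_cast; ring
  rw [Finset.sum_const, nsmul_eq_mul, h5]

/-- The arithmetic-geometric mean inequality over the orderings of `P`: in a uniform ordering each
`x ∈ P` occupies each of the `m` positions equally often, and the set `Q` of the `j` elements before
it is then a uniform `j`-subset of `P \ {x}`. The induction applies Jensen's inequality to the last
element of the ordering, which avoids mentioning permutations. -/
theorem le_log_processWeight {α : Type*} [DecidableEq α] {p : Finset α → α → ℝ} (m : ℕ)
    (P : Finset α) (hm : P.card = m) (hp : ∀ Q ⊆ P, ∀ x ∈ P, x ∉ Q → 0 < p Q x) :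
    Real.log (m.factorial : ℝ) + (∑ j ∈ range m, (∑ x ∈ P, ∑ Q ∈ powersetCard j (P.erase x),
        Real.log (p Q x)) / (m - 1).choose j) / m ≤ Real.log (processWeight p m P) := by
  induction m generalizing P with
  | zero => simp [processWeight]
  | succ m ih =>
    have hne : P.Nonempty := card_pos.1 (by omega)
    have hm0 : (0 : ℝ) < (m : ℝ) + 1 := by positivity
    have hpe : ∀ x ∈ P, ∀ Q ⊆ P.erase x, ∀ y ∈ P.erase x, y ∉ Q → 0 < p Q y :=
      fun x _ Q hQ y hy => hp Q (hQ.trans (erase_subset _ _)) y (mem_of_mem_erase hy)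
    have hce : ∀ x ∈ P, (P.erase x).card = m := fun x hx => by
      rw [card_erase_of_mem hx, hm]; rfl
    have hpx : ∀ x ∈ P, 0 < p (P.erase x) x := fun x hx =>
      hp _ (erase_subset _ _) x hx (notMem_erase _ _)
    have hF : ∀ x ∈ P, 0 < processWeight p m (P.erase x) := fun x hx =>
      processWeight_pos _ _ (hce x hx) (hpe x hx)
    have hpos : 0 < ∑ x ∈ P, processWeight p m (P.erase x) * p (P.erase x) x :=
      Finset.sum_pos (fun x hx => mul_pos (hF x hx) (hpx x hx)) hne
    have h1 := sum_log_div_card_le_log P hne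
      (fun x => processWeight p m (P.erase x) * p (P.erase x) x)
      (fun x hx => mul_pos (hF x hx) (hpx x hx))
    rw [Real.log_div hpos.ne' (by rw [hm]; positivity), hm] at h1
    have h2 : ∑ x ∈ P, (Real.log (m.factorial : ℝ) + (∑ j ∈ range m, (∑ y ∈ P.erase x,
        ∑ Q ∈ powersetCard j ((P.erase x).erase y), Real.log (p Q y)) / (m - 1).choose j) / m
          + Real.log (p (P.erase x) x)) ≤
        ∑ x ∈ P, Real.log (processWeight p m (P.erase x) * p (P.erase x) x) :=
      Finset.sum_le_sum fun x hx => by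
        rw [Real.log_mul (hF x hx).ne' (hpx x hx).ne']
        exact add_le_add_left (ih _ (hce x hx) (hpe x hx)) _
    have h3 : ∑ x ∈ P, (∑ j ∈ range m, (∑ y ∈ P.erase x,
        ∑ Q ∈ powersetCard j ((P.erase x).erase y), Real.log (p Q y)) / (m - 1).choose j) / m =
        ∑ j ∈ range m, (∑ x ∈ P, ∑ Q ∈ powersetCard j (P.erase x),
          Real.log (p Q x)) / m.choose j := by
      rw [← Finset.sum_div, Finset.sum_comm, Finset.sum_div]
      refine Finset.sum_congr rfl fun j hj => ?_
      rw [mem_range] at hj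
      rw [← Finset.sum_div, sum_sum_erase_sum_powersetCard P j (fun Q y => Real.log (p Q y)), hm]
      have hch : ((m : ℝ) - j) * m.choose j = m * (m - 1).choose j := by
        obtain ⟨r, rfl⟩ : ∃ r, m = r + 1 := ⟨m - 1, by omega⟩
        have := Nat.choose_mul_succ_eq r j
        rw [← Nat.cast_sub hj.le, Nat.add_sub_cancel, mul_comm, mul_comm ((r + 1 : ℕ) : ℝ)]
        exact_mod_cast this.symm
      have a1 : (0 : ℝ) < m.choose j := by exact_mod_cast Nat.choose_pos hj.le
      have a2 : (0 : ℝ) < (m - 1).choose j := by exact_mod_cast Nat.choose_pos (by omega)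
      have a3 : (0 : ℝ) < m := by exact_mod_cast (by omega : 0 < m)
      rw [div_div, div_eq_div_iff (by positivity) a1.ne']
      push_cast
      linear_combination (∑ x ∈ P, ∑ Q ∈ powersetCard j (P.erase x), Real.log (p Q x)) * hch
    have h4 : ∑ x ∈ P, ∑ Q ∈ powersetCard m (P.erase x), Real.log (p Q x) =
        ∑ x ∈ P, Real.log (p (P.erase x) x) :=
      Finset.sum_congr rfl fun x hx => by
        rw [← hce x hx, powersetCard_self, sum_singleton]
    rw [Finset.sum_add_distrib, Finset.sum_add_distrib, h3, Finset.sum_const, nsmul_eq_mul, hm] at h2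
    simp only [processWeight]
    rw [Finset.sum_range_succ, Nat.factorial_succ]
    simp only [Nat.add_sub_cancel]
    rw [h4, Nat.choose_self]
    push_cast at h1 h2 ⊢
    rw [Real.log_mul hm0.ne' (by positivity), div_one]
    have h5 := div_le_div_of_nonneg_right h2 hm0.le
    rw [add_assoc, add_div, mul_div_cancel_left₀ _ hm0.ne'] at h5
    linarith

/-! ### Logarithmic sums and the error term -/

theorem log_factorial_le (M : ℕ) (hM : 1 ≤ M) :
    Real.log (M.factorial : ℝ) ≤ M * Real.log M - M + Real.log M + 1 := by
  induction M, hM using Nat.le_induction with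
  | base => simp
  | succ M hM ih =>
    have h0 : (0 : ℝ) < M := by exact_mod_cast hM
    rw [Nat.factorial_succ]
    push_cast
    rw [Real.log_mul (by positivity) (by positivity)]
    have h1 := Real.one_sub_inv_le_log_of_pos (x := ((M : ℝ) + 1) / M) (by positivity)
    rw [Real.log_div (by positivity) (by positivity), inv_div] at h1
    have h2 : 1 - (M : ℝ) / (M + 1) = 1 / (M + 1) := by field_simp; ring
    rw [h2, div_le_iff₀ (by positivity)] at h1
    nlinarith

/-- A discrete form of `∫ log (q + η) dq ≈ -1` over `[0, 1]`. For `i ≥ 1` it follows from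
`log (q + η) ≤ log q + η / q` at `q = i / M`; the term `i = 0` is not positive. -/
theorem sum_log_div_add_le (M : ℕ) (hM : 1 ≤ M) (η : ℝ) (h0 : 0 < η) (h1 : η ≤ 1) :
    ∑ i ∈ range (M + 1), Real.log (i / M + η) ≤
      -M + Real.log M + 1 + η * M * (1 + Real.log M) := by
  have hM0 : (0 : ℝ) < M := by exact_mod_cast hM
  rw [Finset.sum_range_succ']
  have h2 : Real.log (((0 : ℕ) : ℝ) / M + η) ≤ 0 := by
    simpa using Real.log_nonpos h0.le h1
  have h3 : ∀ i ∈ range M, Real.log (((i + 1 : ℕ) : ℝ) / M + η) ≤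
      Real.log ((i + 1 : ℕ) : ℝ) - Real.log M + η * M * ((i + 1 : ℕ) : ℝ)⁻¹ := fun i _ => by
    have hi : (0 : ℝ) < ((i + 1 : ℕ) : ℝ) := by positivity
    have h4 : ((i + 1 : ℕ) : ℝ) / M + η =
        ((i + 1 : ℕ) : ℝ) / M * (1 + η * M * ((i + 1 : ℕ) : ℝ)⁻¹) := by field_simp
    rw [h4, Real.log_mul (by positivity) (by positivity), Real.log_div hi.ne' hM0.ne']
    have := Real.log_le_sub_one_of_pos (x := 1 + η * M * ((i + 1 : ℕ) : ℝ)⁻¹) (by positivity)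
    linarith
  have h5 := Finset.sum_le_sum h3
  rw [Finset.sum_add_distrib, Finset.sum_sub_distrib, ← Finset.mul_sum, Finset.sum_const,
    card_range, nsmul_eq_mul] at h5
  have h6 : ∑ i ∈ range M, Real.log ((i + 1 : ℕ) : ℝ) = Real.log (M.factorial : ℝ) := by
    rw [← Real.log_prod (fun i _ => by positivity), ← Finset.prod_range_add_one_eq_factorial]
    push_cast
    rfl
  have h7 : ∑ i ∈ range M, ((i + 1 : ℕ) : ℝ)⁻¹ ≤ 1 + Real.log M := by
    have := harmonic_le_one_add_log M
    simpa [harmonic] using this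
  have h8 := log_factorial_le M hM
  have h9 : η * M * ∑ i ∈ range M, ((i + 1 : ℕ) : ℝ)⁻¹ ≤ η * M * (1 + Real.log M) := by gcongr
  linarith

/-- The total error is at most `n ^ (2 - 1 / D)` times a multiple of `log n`. Here `D` bounds the
number of edges of a clique, so that `m` is of order `n ^ 2`. -/
theorem exists_forall_error_le (D K : ℝ) (hD : 1 ≤ D) (hK : 0 < K) :
    ∃ n₀ : ℕ, ∀ n : ℕ, n₀ ≤ n → ∀ m : ℕ, (n.choose 2 : ℝ) ≤ D * m → m ≤ n.choose 2 →
      (n.choose 2 : ℝ) * ((2 + Real.log m) / m + (K / n) ^ (1 / D) * (1 + Real.log m)) ≤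
        (n : ℝ) ^ (2 - 1 / (2 * D)) := by
  set K' : ℝ := K ^ (1 / D) with hK'
  have hK'0 : 0 < K' := Real.rpow_pos_of_pos hK _
  have hD0 : 0 < D := by linarith
  have ha : (0 : ℝ) < 1 / (2 * D) := by positivity
  -- half of the exponent gained from `K / n` absorbs the logarithm
  have h1 : ∀ᶠ y : ℝ in Filter.atTop, Real.log y ≤ 1 / (4 * (D + K')) * y ^ (1 / (2 * D)) := by
    filter_upwards [(isLittleO_log_rpow_atTop ha).def (c := 1 / (4 * (D + K'))) (by positivity),
      Filter.eventually_ge_atTop 0] with y hy hy0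
    rw [Real.norm_of_nonneg (Real.rpow_nonneg hy0 _)] at hy
    exact (Real.le_norm_self _).trans hy
  have h2 : ∀ᶠ y : ℝ in Filter.atTop, 4 * (D + K') ≤ y ^ (1 / (2 * D)) :=
    (tendsto_rpow_atTop ha).eventually_ge_atTop _
  have h3 := tendsto_natCast_atTop_atTop (R := ℝ) |>.eventually (h1.and h2)
  obtain ⟨n₀, hn₀⟩ := Filter.eventually_atTop.1 h3
  refine ⟨max n₀ 3, fun n hn m hm1 hm2 => ?_⟩
  obtain ⟨g1, g2⟩ := hn₀ n ((le_max_left _ _).trans hn)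
  have hn3 : 3 ≤ n := (le_max_right _ _).trans hn
  have hnr : (3 : ℝ) ≤ n := by exact_mod_cast hn3
  have hn0 : (0 : ℝ) < n := by linarith
  have hc : (n.choose 2 : ℝ) ≤ (n : ℝ) ^ 2 := by exact_mod_cast Nat.choose_le_pow n 2
  have hcpos : (0 : ℝ) < n.choose 2 := by exact_mod_cast Nat.choose_pos (by omega)
  have hm0 : (0 : ℝ) < m := by
    by_contra h
    nlinarith
  have hm1' : (1 : ℝ) ≤ m := by
    have : 0 < m := by exact_mod_cast hm0
    exact_mod_cast this
  have hlogm : Real.log m ≤ 2 * Real.log n := by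
    rw [← Real.log_rpow hn0]
    refine Real.log_le_log hm0 ?_
    rw [Real.rpow_ofNat]
    exact le_trans (by exact_mod_cast hm2) hc
  have hlogm0 : 0 ≤ Real.log m := Real.log_nonneg hm1'
  have hlogn0 : 0 ≤ Real.log n := Real.log_nonneg (by linarith)
  have hE : (n : ℝ) ^ 2 * (K / n) ^ (1 / D) = K' * (n : ℝ) ^ (2 - 1 / D) := by
    rw [Real.div_rpow hK.le hn0.le, Real.rpow_sub hn0, Real.rpow_ofNat]
    ring
  have hone : 1 ≤ (n : ℝ) ^ (2 - 1 / D) := by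
    refine Real.one_le_rpow (by linarith) ?_
    have : 1 / D ≤ 1 := by rw [div_le_one hD0]; exact hD
    linarith
  have hA : (n.choose 2 : ℝ) * ((2 + Real.log m) / m) ≤
      D * (2 + 2 * Real.log n) * (n : ℝ) ^ (2 - 1 / D) := by
    calc (n.choose 2 : ℝ) * ((2 + Real.log m) / m)
        ≤ (D * m) * ((2 + Real.log m) / m) := by gcongr
      _ = D * (2 + Real.log m) := by field_simp
      _ ≤ D * (2 + 2 * Real.log n) := by gcongr
      _ ≤ _ := le_mul_of_one_le_right (by positivity) hone
  have hB : (n.choose 2 : ℝ) * ((K / n) ^ (1 / D) * (1 + Real.log m)) ≤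
      K' * (2 + 2 * Real.log n) * (n : ℝ) ^ (2 - 1 / D) := by
    calc (n.choose 2 : ℝ) * ((K / n) ^ (1 / D) * (1 + Real.log m))
        ≤ (n : ℝ) ^ 2 * ((K / n) ^ (1 / D) * (2 + 2 * Real.log n)) := by
          gcongr
          norm_num
      _ = ((n : ℝ) ^ 2 * (K / n) ^ (1 / D)) * (2 + 2 * Real.log n) := by ring
      _ = _ := by rw [hE]; ring
  have hfin : (D + K') * (2 + 2 * Real.log n) ≤ (n : ℝ) ^ (1 / (2 * D)) := by
    have : (D + K') * (2 * Real.log n) ≤ (n : ℝ) ^ (1 / (2 * D)) / 2 := by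
      calc (D + K') * (2 * Real.log n)
          ≤ (D + K') * (2 * (1 / (4 * (D + K')) * (n : ℝ) ^ (1 / (2 * D)))) := by gcongr
        _ = _ := by field_simp; ring
    linarith
  have hsplit : (n : ℝ) ^ (2 - 1 / (2 * D)) = (n : ℝ) ^ (1 / (2 * D)) * (n : ℝ) ^ (2 - 1 / D) := by
    rw [← Real.rpow_add hn0]
    congr 1
    field_simp
    ring
  rw [mul_add, hsplit]
  calc _ ≤ _ := add_le_add hA hB
    _ = (D + K') * (2 + 2 * Real.log n) * (n : ℝ) ^ (2 - 1 / D) := by ring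
    _ ≤ _ := by gcongr

/-! ### Sets of vertices and the cliques of a decomposition -/

/-- Each pair of vertices of `U` lies in exactly one clique of `P`. -/
theorem sum_choose_two_card_inter {V : Type*} [DecidableEq V] {P : Finset (Finset V)}
    (hP : ∀ u v : V, u ≠ v → ∃! C : Finset V, C ∈ P ∧ u ∈ C ∧ v ∈ C) (U : Finset V) :
    ∑ C ∈ P, (C ∩ U).card.choose 2 = U.card.choose 2 := by
  have h1 : ∀ C : Finset V, (C ∩ U).card.choose 2 =
      ∑ e ∈ powersetCard 2 U, if e ⊆ C then 1 else 0 := fun C => by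
    rw [← card_powersetCard, ← Finset.card_filter]
    congr 1
    ext e
    simp only [mem_powersetCard, mem_filter, subset_inter_iff]
    tauto
  simp only [h1]
  rw [Finset.sum_comm, ← card_powersetCard, Finset.card_eq_sum_ones]
  refine Finset.sum_congr rfl fun e he => ?_
  obtain ⟨u, v, huv, rfl⟩ := card_eq_two.1 (mem_powersetCard.1 he).2
  obtain ⟨C, hC, hC'⟩ := hP u v huv
  rw [← Finset.card_filter, card_eq_one]
  refine ⟨C, ?_⟩
  ext D
  simp only [mem_filter, mem_singleton, insert_subset_iff, singleton_subset_iff]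
  exact ⟨fun h => hC' D h, fun h => h ▸ hC⟩

theorem card_inter_le_one {V : Type*} [DecidableEq V] {P : Finset (Finset V)}
    (hP : ∀ u v : V, u ≠ v → ∃! C : Finset V, C ∈ P ∧ u ∈ C ∧ v ∈ C) {C D : Finset V}
    (hC : C ∈ P) (hD : D ∈ P) (hCD : C ≠ D) : (C ∩ D).card ≤ 1 := by
  by_contra! h
  obtain ⟨u, hu, v, hv, huv⟩ := one_lt_card.1 h
  rw [mem_inter] at hu hv
  exact hCD ((hP u v huv).unique ⟨hC, hu.1, hv.1⟩ ⟨hD, hu.2, hv.2⟩)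

/-- The `k`-sets of vertices which share no edge with a member of `Q`, that is, which meet every
member of `Q` in at most one vertex. -/
def availableCliques {V : Type*} [Fintype V] [DecidableEq V] (Q : Finset (Finset V)) (k : ℕ) :
    Finset (Finset V) :=
  (powersetCard k univ).filter fun U => ∀ C ∈ Q, (C ∩ U).card ≤ 1

theorem card_filter_superset_le {V : Type*} [Fintype V] [DecidableEq V] (T : Finset V) (k : ℕ) :
    ((powersetCard k univ).filter fun U => T ⊆ U).card * (Fintype.card V).choose T.card ≤
      (Fintype.card V).choose k * k.choose T.card := by
  by_cases hT : T.card ≤ k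
  · rw [Nat.choose_mul hT, mul_comm]
    refine Nat.mul_le_mul_left _ ?_
    rw [← card_compl, ← card_powersetCard]
    refine card_le_card_of_injOn (fun U => U \ T) ?_ ?_
    · intro U hU
      simp only [coe_filter, Set.mem_ofPred_eq, mem_powersetCard_univ] at hU
      simp only [mem_coe, mem_powersetCard, card_sdiff_of_subset hU.2, hU.1, and_true]
      exact fun z hz => mem_compl.2 (mem_sdiff.1 hz).2
    · intro U hU W hW h
      simp only [coe_filter, Set.mem_ofPred_eq] at hU hW h
      rw [← sdiff_union_of_subset hU.2, h, sdiff_union_of_subset hW.2]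
  · have : ((powersetCard k (univ : Finset V)).filter fun U => T ⊆ U) = ∅ := by
      refine filter_eq_empty_iff.2 fun U hU h => hT ?_
      rw [← mem_powersetCard_univ.1 hU]
      exact card_le_card h
    simp [this]

/-- The `k`-sets of vertices which have two edges in a common member of `P`, or an edge in `x`. Two
edges of `U` lie in a common clique `C` exactly if `C` contains three vertices of `U`. -/
def degenerateSets {V : Type*} [Fintype V] [DecidableEq V] (P : Finset (Finset V)) (x : Finset V)
    (k : ℕ) : Finset (Finset V) :=
  (powersetCard k univ).filter fun U => (∃ C ∈ P, 3 ≤ (C ∩ U).card) ∨ 2 ≤ (x ∩ U).card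

/-- A degenerate set contains a triple inside a clique of `P` or a pair inside `x`. There are at most
`L * (n choose 2)` such triples and `L ^ 2` such pairs; a given triple lies in a fraction
`(k choose 3) / (n choose 3)` of all `k`-sets, and a given pair in a fraction
`(k choose 2) / (n choose 2)`. -/
theorem card_degenerateSets_le {V : Type*} [Fintype V] [DecidableEq V] {P : Finset (Finset V)}
    (hP : ∀ u v : V, u ≠ v → ∃! C : Finset V, C ∈ P ∧ u ∈ C ∧ v ∈ C) {L : ℕ}
    (hL : ∀ C ∈ P, C.card ≤ L) {x : Finset V} (hx : x.card ≤ L) {k : ℕ} (hk : k ≤ L)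
    (hV : 3 ≤ Fintype.card V) :
    ((degenerateSets P x k).card : ℝ) ≤
      (Fintype.card V).choose k * (10 * (L : ℝ) ^ 4 / Fintype.card V) := by
  set n := Fintype.card V with hn
  set N : ℝ := (n.choose k : ℝ) with hN
  have hN0 : 0 ≤ N := by positivity
  let Y : Finset V → ℕ := fun T => ((powersetCard k univ).filter fun U => T ⊆ U).card
  have hsub : degenerateSets P x k ⊆
      (P.biUnion fun C => (powersetCard 3 C).biUnion fun T =>
        (powersetCard k univ).filter fun U => T ⊆ U) ∪
      (powersetCard 2 x).biUnion fun T => (powersetCard k univ).filter fun U => T ⊆ U := by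
    intro U hU
    obtain ⟨hUk, hU⟩ := mem_filter.1 hU
    rcases hU with ⟨C, hC, h⟩ | h
    · obtain ⟨T, hT, hTc⟩ := exists_subset_card_eq h
      rw [subset_inter_iff] at hT
      refine mem_union_left _ (mem_biUnion.2 ⟨C, hC, mem_biUnion.2
        ⟨T, mem_powersetCard.2 ⟨hT.1, hTc⟩, mem_filter.2 ⟨hUk, hT.2⟩⟩⟩)
    · obtain ⟨T, hT, hTc⟩ := exists_subset_card_eq h
      rw [subset_inter_iff] at hT
      exact mem_union_right _ (mem_biUnion.2
        ⟨T, mem_powersetCard.2 ⟨hT.1, hTc⟩, mem_filter.2 ⟨hUk, hT.2⟩⟩)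
  have hcard : ((degenerateSets P x k).card : ℝ) ≤
      ∑ C ∈ P, ∑ T ∈ powersetCard 3 C, (Y T : ℝ) + ∑ T ∈ powersetCard 2 x, (Y T : ℝ) := by
    have := (card_le_card hsub).trans ((card_union_le _ _).trans (add_le_add
      (card_biUnion_le.trans (Finset.sum_le_sum fun C _ => card_biUnion_le)) card_biUnion_le))
    exact_mod_cast this
  have hn0 : (3 : ℝ) ≤ n := by exact_mod_cast hV
  have hY : ∀ t, t ≤ n → ∀ T : Finset V, T.card = t →
      (Y T : ℝ) ≤ N * k.choose t / n.choose t := by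
    rintro t htn T rfl
    rw [le_div_iff₀ (by exact_mod_cast Nat.choose_pos htn)]
    rw [hN]
    exact_mod_cast card_filter_superset_le T k
  have hc2 : (n.choose 2 : ℝ) = n * (n - 1) / 2 := Nat.cast_choose_two ℝ n
  have hc3 : (n.choose 3 : ℝ) * 3 = n.choose 2 * (n - 2) := by
    have := Nat.choose_succ_right_eq n 2
    rw [show ((n : ℝ) - 2) = ((n - 2 : ℕ) : ℝ) by rw [Nat.cast_sub (by omega)]; norm_num]
    exact_mod_cast this
  have hkL : ∀ t, (k.choose t : ℝ) ≤ (L : ℝ) ^ t := fun t => by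
    exact_mod_cast (Nat.choose_le_pow k t).trans (Nat.pow_le_pow_left hk t)
  have hpos2 : (0 : ℝ) < n.choose 2 := by exact_mod_cast Nat.choose_pos (by omega)
  have hpos3 : (0 : ℝ) < n.choose 3 := by exact_mod_cast Nat.choose_pos (by omega)
  -- triples inside a common clique
  have hT3 : ∑ C ∈ P, ((C.card.choose 3 : ℕ) : ℝ) ≤ L * n.choose 2 := by
    have h1 := sum_choose_two_card_inter hP (univ : Finset V)
    simp only [inter_univ, card_univ] at h1
    rw [← hn] at h1
    have h2 : ∑ C ∈ P, C.card.choose 3 ≤ L * n.choose 2 := by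
      rw [← h1, Finset.mul_sum]
      refine Finset.sum_le_sum fun C hC => ?_
      have h3 := Nat.choose_succ_right_eq C.card 2
      have h4 : C.card.choose 2 * (C.card - 2) ≤ C.card.choose 2 * L :=
        Nat.mul_le_mul_left _ ((Nat.sub_le _ _).trans (hL C hC))
      rw [mul_comm L]
      norm_num at h3
      omega
    exact_mod_cast h2
  -- the nine comes from `n * (n choose 2) ≤ 9 * (n choose 3)`, which holds for `n ≥ 3`
  have hA : ∑ C ∈ P, ∑ T ∈ powersetCard 3 C, (Y T : ℝ) ≤ N * (9 * (L : ℝ) ^ 4 / n) := by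
    calc ∑ C ∈ P, ∑ T ∈ powersetCard 3 C, (Y T : ℝ)
        ≤ ∑ C ∈ P, ∑ T ∈ powersetCard 3 C, (N * (L : ℝ) ^ 3 / n.choose 3) := by
          refine Finset.sum_le_sum fun C _ => Finset.sum_le_sum fun T hT =>
            (hY 3 hV T (mem_powersetCard.1 hT).2).trans ?_
          gcongr
          exact hkL 3
      _ = (∑ C ∈ P, ((C.card.choose 3 : ℕ) : ℝ)) * (N * (L : ℝ) ^ 3 / n.choose 3) := by
          simp [Finset.sum_mul]
      _ ≤ (L * n.choose 2) * (N * (L : ℝ) ^ 3 / n.choose 3) := by gcongr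
      _ = N * (L : ℝ) ^ 4 * (n.choose 2 / n.choose 3) := by ring
      _ ≤ N * (L : ℝ) ^ 4 * (9 / n) := by
          refine mul_le_mul_of_nonneg_left ?_ (by positivity)
          rw [div_le_div_iff₀ hpos3 (by linarith)]
          nlinarith
      _ = _ := by ring
  have hB : ∑ T ∈ powersetCard 2 x, (Y T : ℝ) ≤ N * ((L : ℝ) ^ 4 / n) := by
    calc ∑ T ∈ powersetCard 2 x, (Y T : ℝ)
        ≤ ∑ T ∈ powersetCard 2 x, (N * (L : ℝ) ^ 2 / n) := by
          refine Finset.sum_le_sum fun T hT =>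
            (hY 2 (by omega) T (mem_powersetCard.1 hT).2).trans ?_
          gcongr
          · exact hkL 2
          · have : (n : ℝ) ≤ n.choose 2 := by rw [hc2]; nlinarith
            exact_mod_cast this
      _ = (x.card.choose 2 : ℕ) * (N * (L : ℝ) ^ 2 / n) := by simp
      _ ≤ (L : ℝ) ^ 2 * (N * (L : ℝ) ^ 2 / n) := by
          gcongr
          exact_mod_cast (Nat.choose_le_pow _ 2).trans (Nat.pow_le_pow_left hx 2)
      _ = _ := by ring
  calc _ ≤ _ := hcard
    _ ≤ _ := add_le_add hA hB
    _ = _ := by ring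

/-- The edges of a nondegenerate `k`-set lie in distinct cliques of `P`, none of them equal to
`x`. -/
theorem card_filter_two_le_card_inter {V : Type*} [Fintype V] [DecidableEq V]
    {P : Finset (Finset V)}
    (hP : ∀ u v : V, u ≠ v → ∃! C : Finset V, C ∈ P ∧ u ∈ C ∧ v ∈ C) {x U : Finset V} {k : ℕ}
    (hU : U ∈ powersetCard k univ) (hU' : U ∉ degenerateSets P x k) :
    ((P.erase x).filter fun C => ¬ (C ∩ U).card ≤ 1).card = k.choose 2 := by
  simp only [degenerateSets, mem_filter, hU, true_and, not_or, not_exists, not_and, not_le] at hU'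
  rw [← mem_powersetCard_univ.1 hU, ← sum_choose_two_card_inter hP U, Finset.card_filter]
  have h1 : ∑ C ∈ P, (C ∩ U).card.choose 2 = ∑ C ∈ P.erase x, (C ∩ U).card.choose 2 := by
    refine (Finset.sum_subset (erase_subset _ _) fun C hC hC' => ?_).symm
    have : C = x := by by_contra h; exact hC' (mem_erase.2 ⟨h, hC⟩)
    exact Nat.choose_eq_zero_of_lt (this ▸ hU'.2)
  rw [h1]
  refine Finset.sum_congr rfl fun C hC => ?_
  have h2 := hU'.1 C (mem_of_mem_erase hC)
  interval_cases (C ∩ U).card <;> rfl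

/-- A uniform `j`-subset of an `M`-set avoids `t` given elements with probability at most
`((M - j) / M) ^ t`. -/
theorem choose_sub_mul_pow_le (M j t : ℕ) (ht : t ≤ M) (hj : j ≤ M) :
    ((M - t).choose j : ℝ) * (M : ℝ) ^ t ≤ M.choose j * ((M : ℝ) - j) ^ t := by
  have hjM : (j : ℝ) ≤ M := by exact_mod_cast hj
  induction t with
  | zero => simp
  | succ t ih =>
    have ih := ih (by omega)
    have htM : (t : ℝ) + 1 ≤ M := by exact_mod_cast ht
    obtain ⟨r, hr⟩ : ∃ r, M = r + 1 + t := ⟨M - 1 - t, by omega⟩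
    have e1 : M - (t + 1) = r := by omega
    have e2 : M - t = r + 1 := by omega
    rw [e2] at ih
    rw [e1]
    have hrM : (M : ℝ) = r + 1 + t := by exact_mod_cast hr
    have hX : (0 : ℝ) ≤ M.choose j * ((M : ℝ) - j) ^ t :=
      mul_nonneg (by positivity) (pow_nonneg (by linarith) _)
    by_cases hjr : j ≤ r + 1
    · have h1 := Nat.choose_mul_succ_eq r j
      have h2 : (r.choose j : ℝ) * (r + 1) = (r + 1).choose j * ((r : ℝ) + 1 - j) := by
        rw [show ((r : ℝ) + 1 - j) = ((r + 1 - j : ℕ) : ℝ) by push_cast [Nat.cast_sub hjr]; ring]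
        exact_mod_cast h1
      have hjr' : (j : ℝ) ≤ r + 1 := by exact_mod_cast hjr
      have hr0 : (0 : ℝ) < (r : ℝ) + 1 := by positivity
      refine le_of_mul_le_mul_right ?_ hr0
      calc (r.choose j : ℝ) * (M : ℝ) ^ (t + 1) * (r + 1)
          = ((r + 1).choose j * (M : ℝ) ^ t) * (((r : ℝ) + 1 - j) * M) := by
            rw [pow_succ]; linear_combination (M : ℝ) ^ t * M * h2
        _ ≤ (M.choose j * ((M : ℝ) - j) ^ t) * (((r : ℝ) + 1 - j) * M) :=
            mul_le_mul_of_nonneg_right ih (mul_nonneg (by linarith) (by positivity))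
        _ ≤ (M.choose j * ((M : ℝ) - j) ^ t) * (((M : ℝ) - j) * (r + 1)) := by
            refine mul_le_mul_of_nonneg_left ?_ hX
            rw [hrM]
            nlinarith [mul_nonneg (Nat.cast_nonneg (α := ℝ) t) (Nat.cast_nonneg (α := ℝ) j)]
        _ = _ := by ring
    · rw [Nat.choose_eq_zero_of_lt (by omega), Nat.cast_zero, zero_mul]
      exact mul_nonneg (by positivity) (pow_nonneg (by linarith) _)

/-- The average number of available `k`-sets after a uniform `j`-subset `Q` of `P \ {x}`, multiplied
by the number `M.choose j` of such subsets. -/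
theorem sum_card_availableCliques_le {V : Type*} [Fintype V] [DecidableEq V]
    {P : Finset (Finset V)}
    (hP : ∀ u v : V, u ≠ v → ∃! C : Finset V, C ∈ P ∧ u ∈ C ∧ v ∈ C) {L : ℕ}
    (hL : ∀ C ∈ P, C.card ≤ L) {x : Finset V} (hx : x.card ≤ L) {k : ℕ} (hk : k ≤ L)
    (hV : 3 ≤ Fintype.card V) {M j : ℕ} (hM : (P.erase x).card = M) (hM0 : 0 < M) (hj : j ≤ M) :
    ∑ Q ∈ powersetCard j (P.erase x), ((availableCliques Q k).card : ℝ) ≤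
      M.choose j * ((Fintype.card V).choose k *
        ((((M : ℝ) - j) / M) ^ k.choose 2 + 10 * (L : ℝ) ^ 4 / Fintype.card V)) := by
  have h1 : ∑ Q ∈ powersetCard j (P.erase x), (availableCliques Q k).card =
      ∑ U ∈ powersetCard k univ,
        (M - ((P.erase x).filter fun C => ¬ (C ∩ U).card ≤ 1).card).choose j := by
    simp only [availableCliques, Finset.card_filter]
    rw [Finset.sum_comm]
    refine Finset.sum_congr rfl fun U _ => ?_
    rw [← Finset.card_filter, ← Finset.card_filter,
      show M - ((P.erase x).filter fun C => ¬ (C ∩ U).card ≤ 1).card =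
        ((P.erase x).filter fun C => (C ∩ U).card ≤ 1).card by
          have := card_filter_add_card_filter_not (s := P.erase x) fun C => (C ∩ U).card ≤ 1
          omega, ← card_powersetCard]
    congr 1
    ext Q
    simp only [mem_filter, mem_powersetCard, subset_iff]
    constructor
    · rintro ⟨⟨a, b⟩, c⟩
      exact ⟨fun C hC => ⟨a hC, c C hC⟩, b⟩
    · rintro ⟨a, b⟩
      exact ⟨⟨fun C hC => (a hC).1, b⟩, fun C hC => (a hC).2⟩
  have hMr : (0 : ℝ) < M := by exact_mod_cast hM0
  have hq : (0 : ℝ) ≤ ((M : ℝ) - j) / M :=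
    div_nonneg (by have : (j : ℝ) ≤ M := by exact_mod_cast hj
                   linarith) hMr.le
  have h2 : ∀ U ∈ powersetCard k (univ : Finset V),
      ((M - ((P.erase x).filter fun C => ¬ (C ∩ U).card ≤ 1).card).choose j : ℝ) ≤
        M.choose j * (((M : ℝ) - j) / M) ^ k.choose 2 +
          M.choose j * (if U ∈ degenerateSets P x k then 1 else 0) := by
    intro U hU
    split_ifs with hd
    · rw [mul_one]
      have : ((M - ((P.erase x).filter fun C => ¬ (C ∩ U).card ≤ 1).card).choose j : ℝ) ≤
          M.choose j := by exact_mod_cast Nat.choose_le_choose j (Nat.sub_le _ _)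
      have : (0 : ℝ) ≤ M.choose j * (((M : ℝ) - j) / M) ^ k.choose 2 := by positivity
      linarith
    · have h3 := card_filter_two_le_card_inter hP hU hd
      have h4 : k.choose 2 ≤ M := by
        rw [← h3, ← hM]
        exact card_filter_le _ _
      rw [h3, mul_zero, add_zero, div_pow, ← mul_div_assoc, le_div_iff₀ (by positivity)]
      exact choose_sub_mul_pow_le M j _ h4 hj
  have h5 := card_degenerateSets_le hP hL hx hk hV
  calc ∑ Q ∈ powersetCard j (P.erase x), ((availableCliques Q k).card : ℝ)
      = ∑ U ∈ powersetCard k univ,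
        ((M - ((P.erase x).filter fun C => ¬ (C ∩ U).card ≤ 1).card).choose j : ℝ) := by
        exact_mod_cast h1
    _ ≤ _ := Finset.sum_le_sum h2
    _ = M.choose j * ((Fintype.card V).choose k * (((M : ℝ) - j) / M) ^ k.choose 2 +
          (degenerateSets P x k).card) := by
        rw [Finset.sum_add_distrib, Finset.sum_const, ← Finset.mul_sum, ← Finset.sum_filter,
          Finset.sum_const, card_powersetCard, card_univ, filter_mem_eq_inter,
          inter_eq_right.2 (show degenerateSets P x k ⊆ powersetCard k univ from filter_subset _ _)]
        simp only [nsmul_eq_mul, mul_one]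
        ring
    _ ≤ _ := by
        rw [mul_add ((Fintype.card V).choose k : ℝ)]
        gcongr

/-! ### The averaged logarithm of the number of available cliques -/

/-- The slack `η` absorbs the degenerate sets, through `q ^ d + η ^ d ≤ (q + η) ^ d`. -/
theorem sum_log_card_availableCliques_le {V : Type*} [Fintype V] [DecidableEq V]
    {P : Finset (Finset V)}
    (hP : ∀ u v : V, u ≠ v → ∃! C : Finset V, C ∈ P ∧ u ∈ C ∧ v ∈ C) {L : ℕ}
    (hL : ∀ C ∈ P, C.card ≤ L) {x : Finset V} (hx : x ∈ P) (hx2 : 2 ≤ x.card)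
    (hV : 3 ≤ Fintype.card V) {M : ℕ} (hM : P.card = M + 1) (hM0 : 0 < M) {η : ℝ} (hη0 : 0 < η)
    (hη1 : η ≤ 1) (hη : 10 * (L : ℝ) ^ 4 / Fintype.card V ≤ η ^ x.card.choose 2) :
    ∑ j ∈ range (M + 1), (∑ Q ∈ powersetCard j (P.erase x),
        Real.log ((availableCliques Q x.card).card : ℝ)) / M.choose j ≤
      (M + 1) * Real.log ((Fintype.card V).choose x.card : ℝ) + x.card.choose 2 *
        (-M + Real.log M + 1 + η * M * (1 + Real.log M)) := by
  have hMr : (0 : ℝ) < M := by exact_mod_cast hM0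
  have hcard : (P.erase x).card = M := by rw [card_erase_of_mem hx, hM]; rfl
  have hd : x.card.choose 2 ≠ 0 := (Nat.choose_pos hx2).ne'
  have hN : (0 : ℝ) < (Fintype.card V).choose x.card := by
    exact_mod_cast Nat.choose_pos (card_le_univ x)
  have hj : ∀ j ∈ range (M + 1), (∑ Q ∈ powersetCard j (P.erase x),
      Real.log ((availableCliques Q x.card).card : ℝ)) / M.choose j ≤
      Real.log ((Fintype.card V).choose x.card : ℝ) + x.card.choose 2 *
        Real.log (((M - j : ℕ) : ℝ) / M + η) := by
    intro j hj
    have hjM : j ≤ M := Nat.lt_succ_iff.1 (mem_range.1 hj)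
    have hS : (powersetCard j (P.erase x)).Nonempty := by
      rw [powersetCard_nonempty, hcard]; exact hjM
    have hch : (0 : ℝ) < M.choose j := by exact_mod_cast Nat.choose_pos hjM
    have hpos : ∀ Q ∈ powersetCard j (P.erase x),
        (0 : ℝ) < (availableCliques Q x.card).card := by
      intro Q hQ
      refine Nat.cast_pos.2 (card_pos.2 ⟨x, mem_filter.2 ⟨mem_powersetCard_univ.2 rfl, ?_⟩⟩)
      intro C hC
      have := mem_erase.1 ((mem_powersetCard.1 hQ).1 hC)
      exact card_inter_le_one hP this.2 hx this.1
    have h1 := sum_log_div_card_le_log _ hS _ hpos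
    rw [card_powersetCard, hcard] at h1
    refine h1.trans ?_
    have h2 := sum_card_availableCliques_le hP hL (hL x hx) (hL x hx) hV hcard hM0 hjM
    rw [← Nat.cast_sub hjM] at h2
    have hq : (0 : ℝ) ≤ ((M - j : ℕ) : ℝ) / M := by positivity
    rw [← Real.log_pow, ← Real.log_mul hN.ne' (by positivity)]
    refine Real.log_le_log (div_pos (Finset.sum_pos hpos hS) hch) ?_
    rw [div_le_iff₀ hch]
    refine h2.trans ?_
    rw [mul_comm]
    gcongr
    exact (add_le_add le_rfl hη).trans (pow_add_pow_le hq hη0.le hd)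
  refine (Finset.sum_le_sum hj).trans ?_
  rw [Finset.sum_add_distrib, ← Finset.mul_sum, Finset.sum_const, card_range, nsmul_eq_mul]
  -- sum over the number `M - j` of remaining cliques instead of `j`
  have h3 := Finset.sum_range_reflect (fun i : ℕ => Real.log ((i : ℝ) / M + η)) (M + 1)
  simp only [Nat.add_sub_cancel] at h3
  rw [h3]
  push_cast
  gcongr
  exact sum_log_div_add_le M hM0 η hη0 hη1

/-! ### Counting decompositions with prescribed clique sizes -/

/-- The probability that the clique process, having chosen the cliques in `Q`, chooses `x` next: it
picks a size `k` with probability `s k / ∑ s i` and then a uniform available `k`-set. If there is no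
available `k`-set, then no choice is made and the probabilities add up to less than one. -/
noncomputable def cliqueStepProb {V : Type*} [Fintype V] [DecidableEq V] (L : ℕ) (s : ℕ → ℕ)
    (Q : Finset (Finset V)) (x : Finset V) : ℝ :=
  ∑ k ∈ Icc 2 L, if x ∈ availableCliques Q k then
    (s k : ℝ) / (∑ i ∈ Icc 2 L, s i : ℕ) / (availableCliques Q k).card else 0

theorem cliqueStepProb_nonneg {V : Type*} [Fintype V] [DecidableEq V] (L : ℕ) (s : ℕ → ℕ)
    (Q : Finset (Finset V)) (x : Finset V) : 0 ≤ cliqueStepProb L s Q x :=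
  Finset.sum_nonneg fun k _ => by split_ifs <;> positivity

theorem sum_cliqueStepProb_le_one {V : Type*} [Fintype V] [DecidableEq V] (L : ℕ) (s : ℕ → ℕ)
    (Q : Finset (Finset V)) : ∑ x, cliqueStepProb L s Q x ≤ 1 := by
  simp only [cliqueStepProb]
  rw [Finset.sum_comm]
  have h : ∀ k ∈ Icc 2 L, ∑ x : Finset V, (if x ∈ availableCliques Q k then
      (s k : ℝ) / (∑ i ∈ Icc 2 L, s i : ℕ) / (availableCliques Q k).card else 0) ≤
      (s k : ℝ) / (∑ i ∈ Icc 2 L, s i : ℕ) := fun k _ => by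
    rw [← Finset.sum_filter, Finset.sum_const, filter_univ_mem, nsmul_eq_mul]
    rcases eq_or_ne ((availableCliques Q k).card : ℝ) 0 with h | h
    · rw [h, zero_mul]
      positivity
    · rw [mul_div_cancel₀ _ h]
  refine (Finset.sum_le_sum h).trans ?_
  rw [← Finset.sum_div]
  push_cast
  exact div_self_le_one _

theorem cliqueStepProb_eq {V : Type*} [Fintype V] [DecidableEq V] {L : ℕ} (s : ℕ → ℕ)
    {Q : Finset (Finset V)} {x : Finset V} (hx : x.card ∈ Icc 2 L)
    (hQ : x ∈ availableCliques Q x.card) : cliqueStepProb L s Q x =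
      (s x.card : ℝ) / (∑ i ∈ Icc 2 L, s i : ℕ) / (availableCliques Q x.card).card := by
  rw [cliqueStepProb, Finset.sum_eq_single_of_mem _ hx, if_pos hQ]
  intro k _ hk
  refine if_neg fun h => hk ?_
  exact (mem_powersetCard_univ.1 (mem_filter.1 h).1).symm

theorem existsUnique_of_mem_prescribed {n L : ℕ} {s : ℕ → ℕ} {P : Finset (Finset (Fin n))}
    (hP : P ∈ prescribedCliqueDecompositions n L s) :
    ∀ u v : Fin n, u ≠ v → ∃! C : Finset (Fin n), C ∈ P ∧ u ∈ C ∧ v ∈ C :=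
  fun u v h => hP.1.2 u v h

/-- The cliques of sizes `2, …, L` already cover all edges, so there are no larger ones. -/
theorem card_mem_Icc_of_mem_prescribed {n L : ℕ} {s : ℕ → ℕ} {P : Finset (Finset (Fin n))}
    (hP : P ∈ prescribedCliqueDecompositions n L s)
    (hs : ∑ k ∈ Icc 2 L, k.choose 2 * s k = n.choose 2) : ∀ C ∈ P, C.card ∈ Icc 2 L := by
  have h1 := sum_choose_two_card_inter (existsUnique_of_mem_prescribed hP) univ
  simp only [inter_univ, card_univ, Fintype.card_fin] at h1
  have h2 : ∑ C ∈ P with C.card ∈ Icc 2 L, C.card.choose 2 = n.choose 2 := by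
    rw [← hs, ← Finset.sum_fiberwise_of_maps_to (t := Icc 2 L) (g := Finset.card)
      fun C hC => (mem_filter.1 hC).2]
    refine Finset.sum_congr rfl fun k hk => ?_
    rw [filter_filter, ← hP.2 k hk, mul_comm, ← smul_eq_mul, ← Finset.sum_const]
    refine Finset.sum_congr ?_ fun C hC => by rw [(mem_filter.1 hC).2]
    ext C
    simp only [mem_filter, and_congr_right_iff, and_iff_right_iff_imp]
    rintro - rfl
    exact hk
  rw [← Finset.sum_filter_add_sum_filter_not P (fun C => C.card ∈ Icc 2 L), h2] at h1
  intro C hC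
  by_contra h
  have h3 : ∑ C ∈ P with C.card ∉ Icc 2 L, C.card.choose 2 = 0 := by omega
  have h4 := Finset.sum_eq_zero_iff.1 h3 C (mem_filter.2 ⟨hC, h⟩)
  exact (Nat.choose_pos (hP.1.1 C hC).1).ne' h4

theorem sum_card_of_mem_prescribed {n L : ℕ} {s : ℕ → ℕ} {P : Finset (Finset (Fin n))}
    (hP : P ∈ prescribedCliqueDecompositions n L s)
    (hs : ∑ k ∈ Icc 2 L, k.choose 2 * s k = n.choose 2) (g : ℕ → ℝ) :
    ∑ C ∈ P, g C.card = ∑ k ∈ Icc 2 L, s k * g k := by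
  rw [← Finset.sum_fiberwise_of_maps_to (card_mem_Icc_of_mem_prescribed hP hs)]
  refine Finset.sum_congr rfl fun k hk => ?_
  rw [← hP.2 k hk, ← nsmul_eq_mul, ← Finset.sum_const]
  exact Finset.sum_congr rfl fun C hC => by rw [(mem_filter.1 hC).2]

/-- The lower bound for the probability that the clique process builds a given decomposition. The
number `M + 1` of cliques is written as a successor because, given `x`, the earlier cliques are
drawn from the `M` others. -/
theorem exp_neg_le_processWeight_cliqueStepProb {n L : ℕ} {s : ℕ → ℕ}
    {P : Finset (Finset (Fin n))} (hP : P ∈ prescribedCliqueDecompositions n L s)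
    (hs : ∑ k ∈ Icc 2 L, k.choose 2 * s k = n.choose 2) (hn : 3 ≤ n) {M : ℕ} (hM0 : 0 < M)
    (hM : ∑ k ∈ Icc 2 L, s k = M + 1) {η : ℝ} (hη0 : 0 < η) (hη1 : η ≤ 1)
    (hη : 10 * (L : ℝ) ^ 4 / n ≤ η ^ (L ^ 2)) :
    Real.exp (-(∑ k ∈ Icc 2 L, (s k : ℝ) * (Real.log (n.choose k : ℝ) - Real.log (s k : ℝ) + 1)
        - (n.choose 2 : ℝ) + n.choose 2 * ((2 + Real.log ((M + 1 : ℕ) : ℝ)) / ((M + 1 : ℕ) : ℝ) +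
          η * (1 + Real.log ((M + 1 : ℕ) : ℝ))))) ≤
      processWeight (cliqueStepProb L s) (M + 1) P := by
  have hpair := existsUnique_of_mem_prescribed hP
  have hIcc := card_mem_Icc_of_mem_prescribed hP hs
  have hsum := sum_card_of_mem_prescribed hP hs
  have hL : ∀ C ∈ P, C.card ≤ L := fun C hC => (mem_Icc.1 (hIcc C hC)).2
  have hcard : P.card = M + 1 := by
    have := hsum fun _ => 1
    simp only [Finset.sum_const, nsmul_eq_mul, mul_one] at this
    rw [← hM]
    exact_mod_cast this
  set m : ℝ := ((M + 1 : ℕ) : ℝ) with hm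
  have hm0 : 0 < m := by positivity
  have hsx : ∀ x ∈ P, (0 : ℝ) < s x.card := fun x hx => by
    rw [← hP.2 _ (hIcc x hx)]
    exact Nat.cast_pos.2 (card_pos.2 ⟨x, mem_filter.2 ⟨hx, rfl⟩⟩)
  have havail : ∀ x ∈ P, ∀ Q ⊆ P, x ∉ Q → x ∈ availableCliques Q x.card := fun x hx Q hQ hxQ =>
    mem_filter.2 ⟨mem_powersetCard_univ.2 rfl, fun C hC =>
      card_inter_le_one hpair (hQ hC) hx fun h => hxQ (h ▸ hC)⟩
  have hApos : ∀ x ∈ P, ∀ Q ⊆ P, x ∉ Q → (0 : ℝ) < (availableCliques Q x.card).card :=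
    fun x hx Q hQ hxQ => Nat.cast_pos.2 (card_pos.2 ⟨x, havail x hx Q hQ hxQ⟩)
  have hstep : ∀ x ∈ P, ∀ Q ⊆ P, x ∉ Q → cliqueStepProb L s Q x =
      (s x.card : ℝ) / m / (availableCliques Q x.card).card := fun x hx Q hQ hxQ => by
    rw [cliqueStepProb_eq s (hIcc x hx) (havail x hx Q hQ hxQ), hM]
  have hppos : ∀ Q ⊆ P, ∀ x ∈ P, x ∉ Q → 0 < cliqueStepProb L s Q x := fun Q hQ x hx hxQ => by
    rw [hstep x hx Q hQ hxQ]
    exact div_pos (div_pos (hsx x hx) hm0) (hApos x hx Q hQ hxQ)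
  rw [← Real.le_log_iff_exp_le (processWeight_pos _ _ hcard hppos)]
  refine le_trans ?_ (le_log_processWeight _ _ hcard hppos)
  -- `E` bounds the sum over `j` of the logarithm of the (perturbed) fraction of remaining cliques
  set E : ℝ := -M + Real.log M + 1 + η * M * (1 + Real.log M) with hE
  have hx : ∀ x ∈ P, m * (Real.log (s x.card) - Real.log m - Real.log (n.choose x.card)) -
      x.card.choose 2 * E ≤ ∑ j ∈ range (M + 1), (∑ Q ∈ powersetCard j (P.erase x),
        Real.log (cliqueStepProb L s Q x)) / M.choose j := by
    intro x hx
    have h1 := sum_log_card_availableCliques_le hpair hL hx (mem_Icc.1 (hIcc x hx)).1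
      (by rwa [Fintype.card_fin]) hcard hM0 hη0 hη1 (by
        rw [Fintype.card_fin]
        exact hη.trans (pow_le_pow_of_le_one hη0.le hη1
          ((Nat.choose_le_pow _ 2).trans (Nat.pow_le_pow_left (hL x hx) 2))))
    rw [Fintype.card_fin] at h1
    have h2 : ∑ j ∈ range (M + 1), (∑ Q ∈ powersetCard j (P.erase x),
        Real.log (cliqueStepProb L s Q x)) / M.choose j =
        ∑ j ∈ range (M + 1), ((Real.log (s x.card) - Real.log m) -
          (∑ Q ∈ powersetCard j (P.erase x),
            Real.log ((availableCliques Q x.card).card : ℝ)) / M.choose j) := by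
      refine Finset.sum_congr rfl fun j hj => ?_
      have hjM : j ≤ M := Nat.lt_succ_iff.1 (mem_range.1 hj)
      have hch : (M.choose j : ℝ) ≠ 0 := by exact_mod_cast (Nat.choose_pos hjM).ne'
      have h3 : ∀ Q ∈ powersetCard j (P.erase x), Real.log (cliqueStepProb L s Q x) =
          (Real.log (s x.card) - Real.log m) -
            Real.log ((availableCliques Q x.card).card : ℝ) := by
        intro Q hQ
        have hQP := (mem_powersetCard.1 hQ).1
        have hQ1 := hQP.trans (erase_subset _ _)
        have hxQ : x ∉ Q := fun h => notMem_erase x P (hQP h)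
        rw [hstep x hx Q hQ1 hxQ, Real.log_div (div_pos (hsx x hx) hm0).ne'
          (hApos x hx Q hQ1 hxQ).ne', Real.log_div (hsx x hx).ne' hm0.ne']
      rw [Finset.sum_congr rfl h3, Finset.sum_sub_distrib, Finset.sum_const, card_powersetCard,
        card_erase_of_mem hx, hcard, Nat.add_sub_cancel, nsmul_eq_mul, sub_div,
        mul_div_cancel_left₀ _ hch]
    rw [h2, Finset.sum_sub_distrib, Finset.sum_const, card_range, nsmul_eq_mul, ← hm]
    have h4 : (M : ℝ) + 1 = m := by rw [hm]; push_cast; rfl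
    rw [h4] at h1
    linarith
  have hswap : ∑ j ∈ range (M + 1), (∑ x ∈ P, ∑ Q ∈ powersetCard j (P.erase x),
      Real.log (cliqueStepProb L s Q x)) / (M.choose j : ℝ) =
      ∑ x ∈ P, ∑ j ∈ range (M + 1), (∑ Q ∈ powersetCard j (P.erase x),
        Real.log (cliqueStepProb L s Q x)) / (M.choose j : ℝ) := by
    rw [Finset.sum_comm]
    exact Finset.sum_congr rfl fun j _ => Finset.sum_div _ _ _
  have htot := Finset.sum_le_sum hx
  rw [hsum fun k => m * (Real.log (s k) - Real.log m - Real.log (n.choose k)) - k.choose 2 * E]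
    at htot
  have hmr : ∑ k ∈ Icc 2 L, (s k : ℝ) = m := by rw [hm, ← hM]; push_cast; rfl
  have hsr : ∑ k ∈ Icc 2 L, (s k : ℝ) * k.choose 2 = n.choose 2 := by
    rw [← hs]; push_cast; exact Finset.sum_congr rfl fun k _ => mul_comm _ _
  have hexp : ∑ k ∈ Icc 2 L, (s k : ℝ) *
      (m * (Real.log (s k) - Real.log m - Real.log (n.choose k)) - k.choose 2 * E) =
      m * (∑ k ∈ Icc 2 L, (s k : ℝ) * (Real.log (s k) - Real.log (n.choose k))) -
        m * m * Real.log m - n.choose 2 * E := by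
    have hmm : m * m * Real.log m = ∑ k ∈ Icc 2 L, (s k : ℝ) * (m * Real.log m) := by
      rw [← Finset.sum_mul, hmr, mul_assoc]
    rw [← hsr, hmm, Finset.mul_sum, Finset.sum_mul, ← Finset.sum_sub_distrib,
      ← Finset.sum_sub_distrib]
    exact Finset.sum_congr rfl fun k _ => by ring
  rw [hexp] at htot
  have hgoal : ∑ k ∈ Icc 2 L, (s k : ℝ) * (Real.log (n.choose k : ℝ) - Real.log (s k : ℝ) + 1) =
      -(∑ k ∈ Icc 2 L, (s k : ℝ) * (Real.log (s k) - Real.log (n.choose k))) + m := by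
    rw [← hmr, ← Finset.sum_neg_distrib, ← Finset.sum_add_distrib]
    exact Finset.sum_congr rfl fun k _ => by ring
  rw [hgoal]
  simp only [Nat.add_sub_cancel]
  rw [hswap, ← hm]
  have hdiv := div_le_div_of_nonneg_right htot hm0.le
  -- `m! ≥ (m / e) ^ m`, in logarithmic form
  have hfac : m * Real.log m - m ≤ Real.log ((M + 1).factorial : ℝ) := by
    have h1 := Real.pow_div_factorial_le_exp m hm0.le (M + 1)
    have h2 := Real.log_le_log (by positivity) h1
    rw [Real.log_exp, Real.log_div (by positivity) (by positivity), Real.log_pow, ← hm] at h2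
    linarith
  have hEm : E / m ≤ -1 + ((2 + Real.log m) / m + η * (1 + Real.log m)) := by
    have hMm : (M : ℝ) = m - 1 := by rw [hm]; push_cast; ring
    have hM1 : (1 : ℝ) ≤ M := by exact_mod_cast hM0
    have hlog : Real.log M ≤ Real.log m := Real.log_le_log (by linarith) (by linarith)
    have hlog0 : 0 ≤ Real.log M := Real.log_nonneg hM1
    have h1 : η * M * (1 + Real.log M) ≤ η * m * (1 + Real.log m) := by
      gcongr
      linarith
    rw [div_le_iff₀ hm0, add_mul, add_mul, div_mul_cancel₀ _ hm0.ne', hE]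
    linarith
  have hEn : (n.choose 2 : ℝ) * (E / m) ≤
      n.choose 2 * (-1 + ((2 + Real.log m) / m + η * (1 + Real.log m))) := by gcongr
  have hsplit : (m * (∑ k ∈ Icc 2 L, (s k : ℝ) * (Real.log (s k) - Real.log (n.choose k))) -
        m * m * Real.log m - n.choose 2 * E) / m =
      (∑ k ∈ Icc 2 L, (s k : ℝ) * (Real.log (s k) - Real.log (n.choose k))) -
        m * Real.log m - n.choose 2 * (E / m) := by
    field_simp
  rw [hsplit] at hdiv
  linarith

theorem ncard_prescribedCliqueDecompositions_le {n L : ℕ} {s : ℕ → ℕ}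
    (hs : ∑ k ∈ Icc 2 L, k.choose 2 * s k = n.choose 2) (hn : 3 ≤ n) {M : ℕ} (hM0 : 0 < M)
    (hM : ∑ k ∈ Icc 2 L, s k = M + 1) {η : ℝ} (hη0 : 0 < η) (hη1 : η ≤ 1)
    (hη : 10 * (L : ℝ) ^ 4 / n ≤ η ^ (L ^ 2)) :
    ((prescribedCliqueDecompositions n L s).ncard : ℝ) ≤
      Real.exp (∑ k ∈ Icc 2 L, (s k : ℝ) * (Real.log (n.choose k : ℝ) - Real.log (s k : ℝ) + 1)
        - (n.choose 2 : ℝ) + n.choose 2 * ((2 + Real.log ((M + 1 : ℕ) : ℝ)) / ((M + 1 : ℕ) : ℝ) +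
          η * (1 + Real.log ((M + 1 : ℕ) : ℝ)))) := by
  classical
  set B := ∑ k ∈ Icc 2 L, (s k : ℝ) * (Real.log (n.choose k : ℝ) - Real.log (s k : ℝ) + 1)
        - (n.choose 2 : ℝ) + n.choose 2 * ((2 + Real.log ((M + 1 : ℕ) : ℝ)) / ((M + 1 : ℕ) : ℝ) +
          η * (1 + Real.log ((M + 1 : ℕ) : ℝ))) with hB
  set Γ := (prescribedCliqueDecompositions n L s).toFinset with hΓ
  have hcardΓ : (prescribedCliqueDecompositions n L s).ncard = Γ.card :=
    Set.ncard_eq_toFinset_card' _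
  have hsub : Γ ⊆ powersetCard (M + 1) univ := fun P hP => by
    rw [hΓ, Set.mem_toFinset] at hP
    have := sum_card_of_mem_prescribed hP hs fun _ => 1
    simp only [Finset.sum_const, nsmul_eq_mul, mul_one] at this
    rw [mem_powersetCard_univ, ← hM]
    exact_mod_cast this
  have h1 : ∀ P ∈ Γ, Real.exp (-B) ≤ processWeight (cliqueStepProb L s) (M + 1) P := by
    intro P hP
    rw [hΓ, Set.mem_toFinset] at hP
    exact exp_neg_le_processWeight_cliqueStepProb hP hs hn hM0 hM hη0 hη1 hη
  have h2 : (Γ.card : ℝ) * Real.exp (-B) ≤ 1 := by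
    rw [← nsmul_eq_mul, ← Finset.sum_const]
    refine (Finset.sum_le_sum h1).trans (le_trans ?_ (sum_processWeight_le_one
      (cliqueStepProb_nonneg (V := Fin n) L s) (sum_cliqueStepProb_le_one L s) (M + 1)))
    exact Finset.sum_le_sum_of_subset_of_nonneg hsub fun P _ _ =>
      processWeight_nonneg (cliqueStepProb_nonneg L s) (M + 1) P
  rw [hcardΓ]
  rwa [Real.exp_neg, ← div_eq_mul_inv, div_le_one (Real.exp_pos _)] at h2

theorem lemma2p2 (L : ℕ) :
    ∃ c : ℝ, 0 < c ∧ ∃ n₀ : ℕ, ∀ n : ℕ, n₀ ≤ n → ∀ s : ℕ → ℕ,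
      ∑ k ∈ Finset.Icc 2 L, k.choose 2 * s k = n.choose 2 →
      ((prescribedCliqueDecompositions n L s).ncard : ℝ) ≤
        Real.exp (∑ k ∈ Finset.Icc 2 L,
            (s k : ℝ) * (Real.log (n.choose k : ℝ) - Real.log (s k : ℝ) + 1)
          - (n.choose 2 : ℝ) + (n : ℝ) ^ (2 - c)) := by
  -- the exponent `L ^ 2 + 1` is at least `k choose 2` for `k ≤ L`, and positive also for `L = 0`
  have hD : (1 : ℝ) ≤ ((L ^ 2 + 1 : ℕ) : ℝ) := by push_cast; nlinarith [sq_nonneg (L : ℝ)]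
  have hK : (0 : ℝ) < 10 * (L : ℝ) ^ 4 + 1 := by positivity
  obtain ⟨n₀, hn₀⟩ := exists_forall_error_le _ _ hD hK
  refine ⟨1 / (2 * ((L ^ 2 + 1 : ℕ) : ℝ)), by positivity,
    max n₀ (max (L ^ 2 + 4) (10 * L ^ 4 + 1)), fun n hn s hs => ?_⟩
  have hn1 : n₀ ≤ n := (le_max_left _ _).trans hn
  have hn2 : L ^ 2 + 4 ≤ n := (le_max_left _ _).trans ((le_max_right _ _).trans hn)
  have hn3 : 10 * L ^ 4 + 1 ≤ n := (le_max_right _ _).trans ((le_max_right _ _).trans hn)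
  have hnr : (0 : ℝ) < n := by exact_mod_cast (by omega : 0 < n)
  have hm1 : n.choose 2 ≤ (L ^ 2 + 1) * ∑ k ∈ Icc 2 L, s k := by
    rw [← hs, Finset.mul_sum]
    refine Finset.sum_le_sum fun k hk => Nat.mul_le_mul_right _ ?_
    exact ((Nat.choose_le_pow k 2).trans (Nat.pow_le_pow_left (mem_Icc.1 hk).2 2)).trans
      (Nat.le_succ _)
  have hm2 : ∑ k ∈ Icc 2 L, s k ≤ n.choose 2 := by
    rw [← hs]
    exact Finset.sum_le_sum fun k hk =>
      Nat.le_mul_of_pos_left _ (Nat.choose_pos (mem_Icc.1 hk).1)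
  have hnc : n ≤ n.choose 2 := by
    have : (n : ℝ) ≤ n.choose 2 := by
      rw [Nat.cast_choose_two]
      have : (4 : ℝ) ≤ n := by exact_mod_cast (by omega : 4 ≤ n)
      nlinarith
    exact_mod_cast this
  obtain ⟨M, hM0, hM⟩ : ∃ M, 0 < M ∧ ∑ k ∈ Icc 2 L, s k = M + 1 := by
    refine ⟨∑ k ∈ Icc 2 L, s k - 1, ?_⟩
    have : 2 ≤ ∑ k ∈ Icc 2 L, s k := by
      by_contra! h
      have : (L ^ 2 + 1) * ∑ k ∈ Icc 2 L, s k ≤ (L ^ 2 + 1) * 1 := Nat.mul_le_mul_left _ (by omega)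
      omega
    omega
  set η : ℝ := ((10 * (L : ℝ) ^ 4 + 1) / n) ^ (1 / ((L ^ 2 + 1 : ℕ) : ℝ)) with hη
  have hbase : (10 * (L : ℝ) ^ 4 + 1) / n ≤ 1 := by
    rw [div_le_one hnr]; exact_mod_cast hn3
  have hη0 : 0 < η := Real.rpow_pos_of_pos (by positivity) _
  have hη1 : η ≤ 1 := Real.rpow_le_one (by positivity) hbase (by positivity)
  have hηpow : η ^ (L ^ 2 + 1) = (10 * (L : ℝ) ^ 4 + 1) / n := by
    rw [hη, one_div, Real.rpow_inv_natCast_pow (by positivity) (by omega)]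
  have hηL : 10 * (L : ℝ) ^ 4 / n ≤ η ^ (L ^ 2) := by
    refine le_trans ?_ (pow_le_pow_of_le_one hη0.le hη1 (Nat.le_succ _))
    rw [hηpow]
    gcongr
    linarith
  refine (ncard_prescribedCliqueDecompositions_le hs (by omega) hM0 hM hη0 hη1 hηL).trans ?_
  have herr := hn₀ n hn1 (M + 1) (by rw [← hM]; exact_mod_cast hm1) (by rw [← hM]; exact hm2)
  gcongr
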